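/- All spaces are real. For a Banach space $E$ and a closed subspace $G\subset E$, write $G^{\perp}\subset E^{*}$ for the annihilator of $G$, $E^{(2n)}$ for the $2n$-th dual of $E$ and $G^{(2n)}\subset E^{(2n)}$ for the $2n$-fold annihilator of $G$ (so $G^{(2)}=G^{\perp\perp}\subset E^{**}$). The subspace $G$ is proximinal if for every $x\in E$ the set $P_G(x)=\{g\in G: \|x-g\|=d(x,G)\}$ is non-empty; it is strongly proximinal if, moreover, for every $x\in E$ and every sequence $(y_n)$ in $G$ with $\|x-y_n\|\to d(x,G)$ there are a subsequence $(y_{n_j})$ and $z_j\in P_G(x)$ with $\|y_{n_j}-z_j\|\to 0$. $\mathcal K(X,E)$ is the space of compact operators from $X$ to $E$ with the operator norm, and $\mathcal K(X,G)$ is its subspace of operators with values in $G$. Let $X$ be a reflexive Banach space, let $Y$ be a Banach space whose dual is isometric to $L^1(\mu)$ for some positive measure $\mu$, and let $Z\subset Y$ be a closed strongly proximinal subspace of finite codimension. Let $k$ be the smallest integer such that $Z^{\perp}$ is contained in the span of $k$ linearly independent extreme points $f_1,\dots,f_k$ of the closed unit ball of $Y^{*}$; this span is denoted by $\ell^1(k)$.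 Assume that $$\mathcal K(X,Z)^{\perp}\subset X\otimes \ell^1(k),$$ where $X\otimes\ell^1(k)$ is regarded as a subspace of $\mathcal K(X,Y)^{*}$ through $(x\otimes g)(T)=g(Tx)$. Then for every $T\in\mathcal K(X,Y^{**})$ there is an $S\in\mathcal K(X,Z^{\perp\perp})$ with $\|T-S\|=d(T,\mathcal K(X,Z^{\perp\perp}))$, that is, $\mathcal K(X,Z^{\perp\perp})$ is a proximinal subspace of $\mathcal K(X,Y^{**})$. More generally, for every $n\ge 1$, $\mathcal K(X,Z^{(2n)})$ is a proximinal subspace of $\mathcal K(X,Y^{(2n)})$; and whenever $Y^{(2n)}$ is identified with $C(K)$, $K$ compact Hausdorff, through a surjective linear isometry $J:Y^{(2n)}\to C(K)$, the subspace $\mathcal K(X,J(Z^{(2n)}))$ is proximinal in $\mathcal K(X,C(K))$. -/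

import Mathlib

open Filter Topology MeasureTheory

universe u v w t

/-- `Z` is a proximinal (closed) subspace of `E`: every `y` has a best approximation in `Z`. -/
def IsProximinal {E : Type u} [NormedAddCommGroup E] [NormedSpace ℝ E]
    (Z : Submodule ℝ E) : Prop :=
  IsClosed (Z : Set E) ∧
    ∀ y : E, ∃ z ∈ Z, ‖y - z‖ = Metric.infDist y (Z : Set E)

/-- The set `P(x)` of best approximants of `x` in `Z`. -/
def bestApproximants {E : Type u} [NormedAddCommGroup E] [NormedSpace ℝ E]
    (Z : Submodule ℝ E) (x : E) : Set E :=
  {z | z ∈ Z ∧ ‖x - z‖ = Metric.infDist x (Z : Set E)}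

/-- `Z` is strongly proximinal: it is proximinal and every minimising sequence for `x` has a
subsequence that approaches the set of best approximants of `x`. -/
def IsStronglyProximinal {E : Type u} [NormedAddCommGroup E] [NormedSpace ℝ E]
    (Z : Submodule ℝ E) : Prop :=
  IsProximinal Z ∧
    ∀ (x : E) (y : ℕ → E), (∀ n, y n ∈ Z) →
      Tendsto (fun n => ‖x - y n‖) atTop (𝓝 (Metric.infDist x (Z : Set E))) →
      ∃ (φ : ℕ → ℕ) (z : ℕ → E), StrictMono φ ∧ (∀ j, z j ∈ bestApproximants Z x) ∧
        Tendsto (fun j => ‖y (φ j) - z j‖) atTop (𝓝 0)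

/-- `X` is reflexive: the canonical embedding of `X` into its bidual is onto. -/
def IsReflexiveSpace (X : Type u) [NormedAddCommGroup X] [NormedSpace ℝ X] : Prop :=
  Function.Surjective (NormedSpace.inclusionInDoubleDual ℝ X)

/-- `Y` is an `L¹`-predual: its dual is linearly isometric to `L¹(μ)` for some positive
measure `μ`. -/
def IsL1Predual (Y : Type v) [NormedAddCommGroup Y] [NormedSpace ℝ Y] : Prop :=
  ∃ (Ω : Type w) (_ : MeasurableSpace Ω) (μ : Measure Ω),
    Nonempty (StrongDual ℝ Y ≃ₗᵢ[ℝ] Lp ℝ 1 μ)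

/-- The annihilator `Z^⊥` of `Z` in the continuous dual. -/
def annihilatorInDual {E : Type u} [NormedAddCommGroup E] [NormedSpace ℝ E]
    (Z : Submodule ℝ E) : Submodule ℝ (StrongDual ℝ E) where
  carrier := {f | ∀ z ∈ Z, f z = 0}
  zero_mem' := fun _ _ => rfl
  add_mem' := by
    intro f g hf hg z hz
    simp [hf z hz, hg z hz]
  smul_mem' := by
    intro c f hf z hz
    simp [hf z hz]

/-- The space `K(X, Y)` of compact operators, with the operator norm. -/
abbrev CompactOps (X : Type u) (Y : Type v) [NormedAddCommGroup X] [NormedSpace ℝ X]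
    [NormedAddCommGroup Y] [NormedSpace ℝ Y] : Type (max u v) :=
  compactOperator (RingHom.id ℝ) X Y

/-- The norm of `K(X, Y)` is the one inherited from the bounded operators (instance shortcut). -/
noncomputable instance instNormedAddCommGroupCompactOps (X : Type u) (Y : Type v)
    [NormedAddCommGroup X] [NormedSpace ℝ X] [NormedAddCommGroup Y] [NormedSpace ℝ Y] :
    NormedAddCommGroup (CompactOps X Y) :=
  Submodule.normedAddCommGroup (compactOperator (RingHom.id ℝ) X Y)

noncomputable instance instNormedSpaceCompactOps (X : Type u) (Y : Type v)
    [NormedAddCommGroup X] [NormedSpace ℝ X] [NormedAddCommGroup Y] [NormedSpace ℝ Y] :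
    NormedSpace ℝ (CompactOps X Y) :=
  Submodule.normedSpace (compactOperator (RingHom.id ℝ) X Y)

/-- The subspace `K(X, Z)` of `K(X, Y)`: the compact operators with values in `Z`. -/
def compactOpsInto (X : Type u) {Y : Type v} [NormedAddCommGroup X] [NormedSpace ℝ X]
    [NormedAddCommGroup Y] [NormedSpace ℝ Y] (Z : Submodule ℝ Y) :
    Submodule ℝ (CompactOps X Y) where
  carrier := {T | ∀ x : X, (T : X →L[ℝ] Y) x ∈ Z}
  zero_mem' := fun _ => Z.zero_mem
  add_mem' := fun hS hT x => Z.add_mem (hS x) (hT x)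
  smul_mem' := fun c _ hT x => Z.smul_mem c (hT x)

/-- `K(X, Z)` is a proximinal subspace of `K(X, Y)`. -/
def CompactOpsProximinal (X : Type u) {Y : Type v} [NormedAddCommGroup X] [NormedSpace ℝ X]
    [NormedAddCommGroup Y] [NormedSpace ℝ Y] (Z : Submodule ℝ Y) : Prop :=
  IsProximinal (compactOpsInto X Z)

/-- The elementary tensor `x ⊗ g` as a functional on `K(X, Y)`: `T ↦ g (T x)`. -/
noncomputable def elementaryTensor {X : Type u} {Y : Type v} [NormedAddCommGroup X]
    [NormedSpace ℝ X] [NormedAddCommGroup Y] [NormedSpace ℝ Y] (x : X) (g : StrongDual ℝ Y) :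
    StrongDual ℝ (CompactOps X Y) :=
  (g.comp (ContinuousLinearMap.apply ℝ Y x)).comp
    (compactOperator (RingHom.id ℝ) X Y).subtypeL

/-- For a finite dimensional subspace `F` of the dual of `Y`, the tensor product `X ⊗ F` as a
subspace of the dual of `K(X, Y)`. -/
noncomputable def tensorSubspace (X : Type u) {Y : Type v} [NormedAddCommGroup X]
    [NormedSpace ℝ X] [NormedAddCommGroup Y] [NormedSpace ℝ Y]
    (F : Submodule ℝ (StrongDual ℝ Y)) : Submodule ℝ (StrongDual ℝ (CompactOps X Y)) :=
  (Submodule.span ℝ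
    {τ | ∃ (x : X) (g : StrongDual ℝ Y), g ∈ F ∧ τ = elementaryTensor x g}).topologicalClosure

/-- `f₁, …, f_k` are linearly independent extreme points of the dual unit ball of `Y` whose span
contains `Z^⊥`. (When `Y` is an `L¹`-predual, this span is a copy of `ℓ¹(k)`.) -/
structure IsExtremeFrame {Y : Type v} [NormedAddCommGroup Y] [NormedSpace ℝ Y]
    (Z : Submodule ℝ Y) (k : ℕ) (f : Fin k → StrongDual ℝ Y) : Prop where
  linearIndependent : LinearIndependent ℝ f
  extreme : ∀ i, f i ∈ Set.extremePoints ℝ (Metric.closedBall (0 : StrongDual ℝ Y) 1)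
  annihilator_le : annihilatorInDual Z ≤ Submodule.span ℝ (Set.range f)

/-- An extreme frame with the smallest possible number `k` of elements. -/
def IsMinimalExtremeFrame {Y : Type v} [NormedAddCommGroup Y] [NormedSpace ℝ Y]
    (Z : Submodule ℝ Y) (k : ℕ) (f : Fin k → StrongDual ℝ Y) : Prop :=
  IsExtremeFrame Z k f ∧ ∀ (m : ℕ) (g : Fin m → StrongDual ℝ Y), IsExtremeFrame Z m g → k ≤ m

/-- A real normed space together with a subspace. -/
structure NormedPair where
  carrier : Type v
  [group : NormedAddCommGroup carrier]
  [space : NormedSpace ℝ carrier]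
  sub : Submodule ℝ carrier

attribute [instance] NormedPair.group NormedPair.space

/-- `(E, Z) ↦ (E^{**}, Z^{⊥⊥})`. -/
noncomputable def NormedPair.bidual (P : NormedPair.{v}) : NormedPair.{v} where
  carrier := StrongDual ℝ (StrongDual ℝ P.carrier)
  sub := annihilatorInDual (annihilatorInDual P.sub)

/-- The dual of order `2n` of `Y`, with the `2n`-fold annihilator of `Z`. -/
noncomputable def evenDual (Y : Type v) [NormedAddCommGroup Y] [NormedSpace ℝ Y]
    (Z : Submodule ℝ Y) : ℕ → NormedPair.{v}
  | 0 => { carrier := Y, sub := Z }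
  | n + 1 => (evenDual Y Z n).bidual

/-! Everything follows from a finite rank contraction `P` on `E` with `x - P x ∈ Z`. Composing a
minimising sequence with `P` confines it to a finite dimensional space, where it has a pointwise
limit; adding `T - P T`, which has values in `Z`, gives a best approximant
(`CompactOpsProximinal.of_reduction`).

For `Z^{⊥⊥}`, such a `P` is the adjoint of a finite rank contraction `Q` of `Y*` fixing `Z^⊥`.
Strong proximinality forbids nonzero `L`-summands of arbitrarily small norm in a functional of `Z^⊥`
(`IsStronglyProximinal.hasIsolatedSummands`). In `L¹(μ)` the restrictions of `f` to measurable sets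
are such summands, so the measure `|f| μ` has no small nonzero values and the elements of `Z^⊥` are
simple functions on a common finite family of sets. Averaging over these sets is `Q`
(`exists_contraction_fixing`). Higher even duals and isometric copies inherit `P` by double adjoints
and conjugation. -/

/-! ### Contractive reductions and best approximation of compact operators -/

/-- There is a contractive finite rank operator `P` with `x - P x ∈ Z` for all `x`. -/
def HasContractiveReduction {E : Type*} [NormedAddCommGroup E] [NormedSpace ℝ E]
    (Z : Submodule ℝ E) : Prop :=
  ∃ P : E →L[ℝ] E, ‖P‖ ≤ 1 ∧ FiniteDimensional ℝ P.range ∧ ∀ x, x - P x ∈ Z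

theorem mem_compactOpsInto {X E : Type*} [NormedAddCommGroup X] [NormedSpace ℝ X]
    [NormedAddCommGroup E] [NormedSpace ℝ E] {Z : Submodule ℝ E} {T : CompactOps X E} :
    T ∈ compactOpsInto X Z ↔ ∀ x : X, (T : X →L[ℝ] E) x ∈ Z := Iff.rfl

theorem isClosed_compactOpsInto {X E : Type*} [NormedAddCommGroup X] [NormedSpace ℝ X]
    [NormedAddCommGroup E] [NormedSpace ℝ E] {Z : Submodule ℝ E} (hZ : IsClosed (Z : Set E)) :
    IsClosed (compactOpsInto X Z : Set (CompactOps X E)) := by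
  have h : (compactOpsInto X Z : Set (CompactOps X E)) =
      ⋂ x : X, {T : CompactOps X E | (T : X →L[ℝ] E) x ∈ Z} := by
    ext T
    simp [mem_compactOpsInto]
  rw [h]
  refine isClosed_iInter fun x => hZ.preimage ?_
  exact ((ContinuousLinearMap.apply ℝ E x).comp
    (compactOperator (RingHom.id ℝ) X E).subtypeL).continuous

/-- A bounded sequence of operators into a proper space has a pointwise limit along any
ultrafilter. -/
theorem exists_pointwise_limit {X W : Type*} [NormedAddCommGroup X] [NormedSpace ℝ X]
    [NormedAddCommGroup W] [NormedSpace ℝ W] [ProperSpace W] (R : ℕ → X →L[ℝ] W) (M : ℝ)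
    (hR : ∀ n, ‖R n‖ ≤ M) (U : Ultrafilter ℕ) :
    ∃ R' : X →L[ℝ] W, ∀ x, Tendsto (fun n => R n x) U (𝓝 (R' x)) := by
  have hc := ContinuousLinearMap.isCompact_image_coe_closedBall (0 : X →L[ℝ] W) M
  obtain ⟨_, ⟨R', -, rfl⟩, hR'⟩ := hc.ultrafilter_le_nhds (U.map fun n => (R n : X → W)) (by
    rw [le_principal_iff]
    refine Filter.mem_map.2 (Filter.univ_mem' fun n => ⟨R n, ?_, rfl⟩)
    simpa using hR n)
  exact ⟨R', fun x => tendsto_pi_nhds.1 hR' x⟩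

theorem CompactOpsProximinal.of_reduction (X : Type u) {E : Type v} [NormedAddCommGroup X]
    [NormedSpace ℝ X] [NormedAddCommGroup E] [NormedSpace ℝ E] {Z : Submodule ℝ E}
    (hZ : IsClosed (Z : Set E)) (h : HasContractiveReduction Z) : CompactOpsProximinal X Z := by
  refine ⟨isClosed_compactOpsInto hZ, fun T => ?_⟩
  obtain ⟨P, hP, hfin, hPZ⟩ := h
  set d := Metric.infDist T (compactOpsInto X Z : Set (CompactOps X E)) with hd
  have hne : (compactOpsInto X Z : Set (CompactOps X E)).Nonempty := ⟨0, zero_mem _⟩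
  have hmin : ∀ n : ℕ, ∃ S ∈ compactOpsInto X Z, ‖T - S‖ < d + 1 / ((n : ℝ) + 1) := by
    intro n
    obtain ⟨S, hS, hlt⟩ := (Metric.infDist_lt_iff hne).1
      (lt_add_of_pos_right d (Nat.one_div_pos_of_nat (n := n)))
    exact ⟨S, hS, by rwa [← dist_eq_norm]⟩
  choose S hS hSd using hmin
  -- `P (S n x)` stays in `Z`, because it differs from `S n x ∈ Z` by an element of `Z`.
  let W : Submodule ℝ E := P.range ⊓ Z
  have : FiniteDimensional ℝ W := Submodule.finiteDimensional_of_le inf_le_left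
  have : ProperSpace W := FiniteDimensional.proper ℝ W
  have hmem : ∀ n x, (P.comp (S n : X →L[ℝ] E)) x ∈ W := fun n x =>
    ⟨⟨_, rfl⟩, by
      have := Z.sub_mem (hS n x) (hPZ ((S n : X →L[ℝ] E) x))
      simpa using this⟩
  let R : ℕ → X →L[ℝ] W := fun n => (P.comp (S n : X →L[ℝ] E)).codRestrict W (hmem n)
  have hRn : ∀ n, ‖R n‖ ≤ ‖T‖ + d + 1 := by
    intro n
    have h1 : ‖S n‖ ≤ ‖T‖ + d + 1 := by
      have h2 : ‖S n‖ ≤ ‖T‖ + ‖T - S n‖ := by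
        rw [norm_sub_rev]; exact norm_le_norm_add_norm_sub' _ _
      have h3 : 1 / ((n : ℝ) + 1) ≤ 1 := by
        rw [div_le_one (by positivity)]; linarith [n.cast_nonneg (α := ℝ)]
      linarith [hSd n]
    refine ContinuousLinearMap.opNorm_le_bound _ ((norm_nonneg _).trans h1) fun x => ?_
    calc ‖R n x‖ = ‖P ((S n : X →L[ℝ] E) x)‖ := rfl
      _ ≤ 1 * ‖(S n : X →L[ℝ] E) x‖ := P.le_of_opNorm_le hP _
      _ ≤ ‖(S n : X →L[ℝ] E)‖ * ‖x‖ := by rw [one_mul]; exact ContinuousLinearMap.le_opNorm _ _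
      _ ≤ _ := mul_le_mul_of_nonneg_right h1 (norm_nonneg _)
  -- An ultrafilter gives convergence at all points at once; `X` need not be separable, so a
  -- subsequence might not do.
  obtain ⟨R', hR'⟩ := exists_pointwise_limit R _ hRn (hyperfilter ℕ)
  have hcomp : IsCompactOperator (fun x => ((T : X →L[ℝ] E) x - P ((T : X →L[ℝ] E) x)) + R' x) := by
    have hT : IsCompactOperator (T : X →L[ℝ] E) := T.2
    refine (hT.sub (hT.clm_comp P)).add ?_
    exact (isCompactOperator_of_locallyCompactSpace_dom (R' : X →L[ℝ] W)).clm_comp W.subtypeL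
  -- Chosen so that `T - S' = P T - R'`, the pointwise limit of `P (T - S n)`, whose norms are at
  -- most `‖T - S n‖`.
  let S' : CompactOps X E :=
    ⟨(T : X →L[ℝ] E) - P.comp (T : X →L[ℝ] E) + W.subtypeL.comp R', hcomp⟩
  have hS' : S' ∈ compactOpsInto X Z := fun x => Z.add_mem (hPZ _) (R' x).2.2
  refine ⟨S', hS', le_antisymm ?_ ?_⟩
  · refine ContinuousLinearMap.opNorm_le_bound _ Metric.infDist_nonneg fun x => ?_
    have hx : ((T - S' : CompactOps X E) : X →L[ℝ] E) x = P ((T : X →L[ℝ] E) x) - R' x := by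
      change (T : X →L[ℝ] E) x - ((T : X →L[ℝ] E) x - P ((T : X →L[ℝ] E) x) + R' x) = _
      abel
    change ‖((T - S' : CompactOps X E) : X →L[ℝ] E) x‖ ≤ _
    rw [hx]
    have hlim : Tendsto (fun n => ‖P ((T : X →L[ℝ] E) x) - (R n x : E)‖) (hyperfilter ℕ)
        (𝓝 ‖P ((T : X →L[ℝ] E) x) - (R' x : E)‖) :=
      (tendsto_const_nhds.sub ((continuous_subtype_val.tendsto _).comp (hR' x))).norm
    have hlim' : Tendsto (fun n : ℕ => (d + 1 / ((n : ℝ) + 1)) * ‖x‖) (hyperfilter ℕ)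
        (𝓝 (d * ‖x‖)) := by
      have := (tendsto_one_div_add_atTop_nhds_zero_nat (𝕜 := ℝ)).const_add d |>.mul_const ‖x‖
      rw [add_zero] at this
      exact this.mono_left Nat.hyperfilter_le_atTop
    refine le_of_tendsto_of_tendsto hlim hlim' (Eventually.of_forall fun n => ?_)
    calc ‖P ((T : X →L[ℝ] E) x) - (R n x : E)‖
        = ‖P (((T - S n : CompactOps X E) : X →L[ℝ] E) x)‖ := by
          congr 1
          exact (map_sub P _ _).symm
      _ ≤ 1 * ‖((T - S n : CompactOps X E) : X →L[ℝ] E) x‖ := P.le_of_opNorm_le hP _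
      _ ≤ ‖T - S n‖ * ‖x‖ := by rw [one_mul]; exact ContinuousLinearMap.le_opNorm _ _
      _ ≤ _ := mul_le_mul_of_nonneg_right (hSd n).le (norm_nonneg _)
  · rw [← dist_eq_norm]
    exact Metric.infDist_le_dist_of_mem hS'

/-! ### Annihilators, adjoints and passage to even duals -/

theorem mem_annihilatorInDual {E : Type*} [NormedAddCommGroup E] [NormedSpace ℝ E]
    {Z : Submodule ℝ E} {f : StrongDual ℝ E} :
    f ∈ annihilatorInDual Z ↔ ∀ z ∈ Z, f z = 0 := Iff.rfl

theorem isClosed_annihilatorInDual {E : Type*} [NormedAddCommGroup E] [NormedSpace ℝ E]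
    (Z : Submodule ℝ E) : IsClosed (annihilatorInDual Z : Set (StrongDual ℝ E)) := by
  have h : (annihilatorInDual Z : Set (StrongDual ℝ E)) =
      ⋂ z ∈ Z, {f : StrongDual ℝ E | f z = 0} := by
    ext f
    simp [mem_annihilatorInDual]
  rw [h]
  exact isClosed_biInter fun z _ =>
    isClosed_eq (ContinuousLinearMap.apply ℝ ℝ z).continuous continuous_const

/-- The adjoint of a bounded operator. -/
noncomputable def adjointOp {E : Type*} [NormedAddCommGroup E] [NormedSpace ℝ E]
    (P : E →L[ℝ] E) : StrongDual ℝ E →L[ℝ] StrongDual ℝ E :=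
  (ContinuousLinearMap.compL ℝ E E ℝ).flip P

@[simp] theorem adjointOp_apply {E : Type*} [NormedAddCommGroup E] [NormedSpace ℝ E]
    (P : E →L[ℝ] E) (f : StrongDual ℝ E) (x : E) : adjointOp P f x = f (P x) := rfl

theorem norm_adjointOp_le {E : Type*} [NormedAddCommGroup E] [NormedSpace ℝ E]
    (P : E →L[ℝ] E) : ‖adjointOp P‖ ≤ ‖P‖ :=
  ContinuousLinearMap.opNorm_le_bound _ (norm_nonneg _) fun f => by
    rw [mul_comm]
    exact ContinuousLinearMap.opNorm_comp_le f P

/-- `f ∘ P` depends only on the restriction of `f` to the range of `P`. -/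
theorem finiteDimensional_range_adjointOp {E : Type*} [NormedAddCommGroup E] [NormedSpace ℝ E]
    (P : E →L[ℝ] E) [FiniteDimensional ℝ P.range] :
    FiniteDimensional ℝ (adjointOp P).range := by
  let Pr : E →L[ℝ] P.range := P.codRestrict P.range fun x => ⟨x, rfl⟩
  let A : StrongDual ℝ P.range →ₗ[ℝ] StrongDual ℝ E :=
    ((ContinuousLinearMap.compL ℝ E P.range ℝ).flip Pr).toLinearMap
  have : FiniteDimensional ℝ (StrongDual ℝ P.range) :=
    Module.Finite.equiv (LinearMap.toContinuousLinearMap (𝕜 := ℝ) (E := P.range) (F' := ℝ))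
  refine Submodule.finiteDimensional_of_le (S₂ := LinearMap.range A) ?_
  rintro _ ⟨f, rfl⟩
  exact ⟨f.comp P.range.subtypeL, rfl⟩

/-- The adjoint of a contractive finite rank operator fixing `Z^⊥` reduces modulo `Z^{⊥⊥}`. -/
theorem HasContractiveReduction.of_fixing {E : Type*} [NormedAddCommGroup E] [NormedSpace ℝ E]
    (V : Submodule ℝ E) (Q : E →L[ℝ] E) (hQ : ‖Q‖ ≤ 1)
    (hfin : FiniteDimensional ℝ Q.range) (hfix : ∀ f ∈ V, Q f = f) :
    HasContractiveReduction (annihilatorInDual V) :=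
  ⟨adjointOp Q, (norm_adjointOp_le Q).trans hQ, finiteDimensional_range_adjointOp Q,
    fun φ f hf => by simp [hfix f hf]⟩

/-- A functional in `Z^⊥` kills `x - P x`, so the adjoint of `P` fixes `Z^⊥`, and the second adjoint
is a reduction for `Z^{⊥⊥}`. -/
theorem HasContractiveReduction.bidual {E : Type*} [NormedAddCommGroup E] [NormedSpace ℝ E]
    {Z : Submodule ℝ E} (h : HasContractiveReduction Z) :
    HasContractiveReduction (annihilatorInDual (annihilatorInDual Z)) := by
  obtain ⟨P, hP, hfin, hPZ⟩ := h
  refine .of_fixing _ (adjointOp P) ((norm_adjointOp_le P).trans hP)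
    (finiteDimensional_range_adjointOp P) fun f hf => ?_
  ext x
  have := hf _ (hPZ x)
  rw [map_sub, sub_eq_zero] at this
  exact this.symm

theorem HasContractiveReduction.map {E F : Type*} [NormedAddCommGroup E] [NormedSpace ℝ E]
    [NormedAddCommGroup F] [NormedSpace ℝ F] {Z : Submodule ℝ E} (h : HasContractiveReduction Z)
    (J : E ≃ₗᵢ[ℝ] F) : HasContractiveReduction (Z.map (J.toLinearEquiv : E →ₗ[ℝ] F)) := by
  obtain ⟨P, hP, hfin, hPZ⟩ := h
  let JL : E →L[ℝ] F := J.toContinuousLinearEquiv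
  let JS : F →L[ℝ] E := J.symm.toContinuousLinearEquiv
  refine ⟨JL.comp (P.comp JS), ?_, ?_, fun y => ⟨J.symm y - P (J.symm y), hPZ _, ?_⟩⟩
  · refine ContinuousLinearMap.opNorm_le_bound _ zero_le_one fun y => ?_
    change ‖J (P (J.symm y))‖ ≤ _
    rw [J.norm_map, ← J.symm.norm_map y]
    exact P.le_of_opNorm_le hP _
  · refine Submodule.finiteDimensional_of_le
      (S₂ := P.range.map (J.toLinearEquiv : E →ₗ[ℝ] F)) ?_
    rintro _ ⟨y, rfl⟩
    exact ⟨P (J.symm y), ⟨_, rfl⟩, rfl⟩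
  · change J (J.symm y - P (J.symm y)) = y - J (P (J.symm y))
    simp

theorem isClosed_map_linearIsometryEquiv {E F : Type*} [NormedAddCommGroup E] [NormedSpace ℝ E]
    [NormedAddCommGroup F] [NormedSpace ℝ F] {Z : Submodule ℝ E} (hZ : IsClosed (Z : Set E))
    (J : E ≃ₗᵢ[ℝ] F) : IsClosed (Z.map (J.toLinearEquiv : E →ₗ[ℝ] F) : Set F) := by
  rw [Submodule.map_coe]
  exact J.toHomeomorph.isClosedMap _ hZ

theorem evenDual_reduction {Y : Type v} [NormedAddCommGroup Y] [NormedSpace ℝ Y]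
    {Z : Submodule ℝ Y} (h : HasContractiveReduction (annihilatorInDual (annihilatorInDual Z)))
    (n : ℕ) : IsClosed ((evenDual Y Z (n + 1)).sub : Set (evenDual Y Z (n + 1)).carrier) ∧
      HasContractiveReduction (evenDual Y Z (n + 1)).sub := by
  refine ⟨isClosed_annihilatorInDual _, ?_⟩
  induction n with
  | zero => exact h
  | succ n ih => exact ih.bidual

/-! ### Strong proximinality and small summands -/

/-- A functional vanishing on a strongly proximinal subspace of finite codimension is strongly
subdifferentiable: almost norming elements are near norming elements. -/
theorem IsStronglyProximinal.exists_near_norming {Y : Type*} [NormedAddCommGroup Y]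
    [NormedSpace ℝ Y] {Z : Submodule ℝ Y} (hcodim : FiniteDimensional ℝ (Y ⧸ Z))
    (hZ : IsStronglyProximinal Z) {f : StrongDual ℝ Y} (hf : f ∈ annihilatorInDual Z)
    (hf0 : f ≠ 0) (y : ℕ → Y) (hy : ∀ n, ‖y n‖ ≤ 1)
    (hfy : Tendsto (fun n => f (y n)) atTop (𝓝 ‖f‖)) {η : ℝ} (hη : 0 < η) :
    ∃ (n : ℕ) (w : Y), ‖w‖ ≤ 1 ∧ f w = ‖f‖ ∧ ‖y n - w‖ < η := by
  have : IsClosed (Z : Set Y) := hZ.1.1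
  have : ProperSpace (Y ⧸ Z) := FiniteDimensional.proper ℝ (Y ⧸ Z)
  -- The unit ball of the quotient is compact, so along a subsequence `y` is `x + z n` up to a null
  -- sequence, with `z n ∈ Z`. Then `-z n` is minimising for `x`, whose distance to `Z` turns out to
  -- be `1`, and `x` minus a best approximant norms `f`.
  obtain ⟨q, -, ψ, hψ, hq⟩ := tendsto_subseq_of_bounded
    (Metric.isBounded_closedBall (x := (0 : Y ⧸ Z)) (r := 1)) (x := fun n => Z.mkQ (y n))
    (fun n => by
      rw [mem_closedBall_zero_iff]
      exact (Submodule.Quotient.norm_mk_le Z (y n)).trans (hy n))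
  obtain ⟨x, rfl⟩ := Z.mkQ_surjective q
  have hz : ∀ n, ∃ z ∈ Z, ‖y (ψ n) - x - z‖ <
      ‖Z.mkQ (y (ψ n)) - Z.mkQ x‖ + 1 / ((n : ℝ) + 1) := by
    intro n
    rw [← map_sub]
    obtain ⟨m, hm, hlt⟩ := Submodule.Quotient.norm_mk_lt (S := Z) (Z.mkQ (y (ψ n) - x))
      (Nat.one_div_pos_of_nat (n := n) (α := ℝ))
    refine ⟨y (ψ n) - x - m, ?_, by simpa using hlt⟩
    exact (Submodule.Quotient.eq Z).1 hm.symm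
  choose z hzZ hzlt using hz
  have hsmall : Tendsto (fun n => ‖y (ψ n) - x - z n‖) atTop (𝓝 0) := by
    refine squeeze_zero (fun _ => norm_nonneg _) (fun n => (hzlt n).le) ?_
    have h1 := tendsto_iff_norm_sub_tendsto_zero.1 hq
    simpa using h1.add (tendsto_one_div_add_atTop_nhds_zero_nat (𝕜 := ℝ))
  have hsmall' := tendsto_zero_iff_norm_tendsto_zero.2 hsmall
  have hfx : f x = ‖f‖ := by
    have h1 : Tendsto (fun n => f (y (ψ n)) - f (y (ψ n) - x - z n)) atTop (𝓝 (‖f‖ - f 0)) :=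
      (hfy.comp hψ.tendsto_atTop).sub ((f.continuous.tendsto 0).comp hsmall')
    refine tendsto_nhds_unique ?_ (by simpa using h1)
    refine tendsto_const_nhds.congr fun n => ?_
    simp [hf _ (hzZ n)]
  set d := Metric.infDist x (Z : Set Y)
  have hfpos : 0 < ‖f‖ := norm_pos_iff.2 hf0
  have hd1 : 1 ≤ d := by
    refine (Metric.le_infDist ⟨0, Z.zero_mem⟩).2 fun m hm => ?_
    have h1 : f (x - m) = ‖f‖ := by rw [map_sub, hf m hm, sub_zero, hfx]
    have h2 := (le_abs_self _).trans (f.le_opNorm (x - m))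
    rw [h1] at h2
    rw [dist_eq_norm]
    exact le_of_mul_le_mul_left (by simpa using h2) hfpos
  have hupper : ∀ n, ‖x - -z n‖ ≤ 1 + ‖y (ψ n) - x - z n‖ := fun n => by
    have : x - -z n = y (ψ n) - (y (ψ n) - x - z n) := by abel
    rw [this]
    exact (norm_sub_le _ _).trans (by linarith [hy (ψ n)])
  have hlower : ∀ n, d ≤ ‖x - -z n‖ := fun n => by
    rw [← dist_eq_norm]
    exact Metric.infDist_le_dist_of_mem (Z.neg_mem (hzZ n))
  have hlim1 : Tendsto (fun n => 1 + ‖y (ψ n) - x - z n‖) atTop (𝓝 1) := by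
    simpa using hsmall.const_add 1
  have hd : d = 1 := le_antisymm
    (ge_of_tendsto hlim1 (Eventually.of_forall fun n => (hlower n).trans (hupper n))) hd1
  obtain ⟨φ, b, hφ, hb, hlim⟩ := hZ.2 x (fun n => -z n) (fun n => Z.neg_mem (hzZ n))
    (tendsto_of_tendsto_of_tendsto_of_le_of_le tendsto_const_nhds (hd ▸ hlim1) hlower hupper)
  have htot := (hsmall.comp hφ.tendsto_atTop).add hlim
  rw [add_zero] at htot
  obtain ⟨j, hj⟩ := (htot.eventually_lt_const hη).exists
  refine ⟨ψ (φ j), x - b j, ?_, ?_, lt_of_le_of_lt ?_ hj⟩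
  · rw [(hb j).2]; exact hd.le
  · rw [map_sub, hf _ (hb j).1, sub_zero, hfx]
  · have h1 : y (ψ (φ j)) - (x - b j) =
        (y (ψ (φ j)) - x - z (φ j)) - (-z (φ j) - b j) := by abel
    rw [h1]
    exact norm_sub_le _ _

/-- The `L`-summands `r` of `f` have norms bounded away from zero. -/
def HasIsolatedSummands {E : Type*} [NormedAddCommGroup E] (f : E) : Prop :=
  ∃ δ > 0, ∀ p r : E, f = p + r → ‖f‖ = ‖p‖ + ‖r‖ → ‖p - r‖ = ‖f‖ → r ≠ 0 → δ ≤ ‖r‖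

theorem exists_norm_le_one_sub_lt {Y : Type*} [NormedAddCommGroup Y] [NormedSpace ℝ Y]
    (g : StrongDual ℝ Y) {ε : ℝ} (hε : 0 < ε) : ∃ y : Y, ‖y‖ ≤ 1 ∧ ‖g‖ - ε < g y := by
  obtain ⟨y, hy, h⟩ := g.exists_lt_apply_of_lt_opNorm (sub_lt_self ‖g‖ hε)
  rcases le_total 0 (g y) with h0 | h0
  · exact ⟨y, hy.le, by rwa [Real.norm_of_nonneg h0] at h⟩
  · exact ⟨-y, by simpa using hy.le, by rwa [Real.norm_of_nonpos h0, ← map_neg] at h⟩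

/-- Suppose `r n → 0` are nonzero summands. Vectors almost norming `p n - r n` almost norm `f`, so
one of them is within `1` of some `w` norming `f`. But `w` norms both summands, so `r n w = ‖r n‖`,
whereas `r n (y n)` is nearly `-‖r n‖`: the distance would have to be nearly `2`. -/
theorem IsStronglyProximinal.hasIsolatedSummands {Y : Type*} [NormedAddCommGroup Y]
    [NormedSpace ℝ Y] {Z : Submodule ℝ Y} (hcodim : FiniteDimensional ℝ (Y ⧸ Z))
    (hZ : IsStronglyProximinal Z) {f : StrongDual ℝ Y} (hf : f ∈ annihilatorInDual Z) :
    HasIsolatedSummands f := by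
  by_contra hcon
  unfold HasIsolatedSummands at hcon
  push Not at hcon
  have h1 := fun n : ℕ => hcon (1 / ((n : ℝ) + 1)) Nat.one_div_pos_of_nat
  choose p r hpr hadd hsub hr0 hlt using h1
  have hrpos : ∀ n, 0 < ‖r n‖ := fun n => norm_pos_iff.2 (hr0 n)
  -- The error must be small compared with `‖r n‖`, hence the square.
  choose y hy hgy using fun n =>
    exists_norm_le_one_sub_lt (p n - r n) (pow_pos (hrpos n) 2)
  have happ : ∀ (g : StrongDual ℝ Y) (x : Y), ‖x‖ ≤ 1 → |g x| ≤ ‖g‖ := fun g x hx =>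
    (g.le_opNorm x).trans (mul_le_of_le_one_right (norm_nonneg _) hx)
  have hfx : ∀ n x, f x = p n x + r n x := fun n x => by
    conv_lhs => rw [hpr n]
    rfl
  have hg : ∀ n, ‖f‖ - ‖r n‖ ^ 2 < p n (y n) - r n (y n) := fun n => by
    have := hgy n
    rwa [hsub n] at this
  have hrlim : Tendsto (fun n => ‖r n‖) atTop (𝓝 0) :=
    squeeze_zero (fun _ => norm_nonneg _) (fun n => (hlt n).le)
      (tendsto_one_div_add_atTop_nhds_zero_nat (𝕜 := ℝ))
  have hf0 : f ≠ 0 := fun h => by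
    have := hadd 0
    rw [h, norm_zero] at this
    linarith [hrpos 0, norm_nonneg (p 0)]
  have hfy : Tendsto (fun n => f (y n)) atTop (𝓝 ‖f‖) := by
    have hlow : Tendsto (fun n => ‖f‖ - ‖r n‖ ^ 2 - 2 * ‖r n‖) atTop (𝓝 ‖f‖) := by
      have := (tendsto_const_nhds (x := ‖f‖)).sub (hrlim.pow 2) |>.sub (hrlim.const_mul 2)
      simpa using this
    refine tendsto_of_tendsto_of_tendsto_of_le_of_le hlow tendsto_const_nhds (fun n => ?_)
      fun n => (le_abs_self _).trans (happ f _ (hy n))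
    have h2 := (abs_le.1 (happ (r n) _ (hy n))).1
    change _ ≤ f (y n)
    rw [hfx n]
    linarith [hg n]
  obtain ⟨n, w, hw, hfw, hnear⟩ := hZ.exists_near_norming hcodim hf hf0 y hy hfy one_pos
  have h2 := (abs_le.1 (happ (p n) _ (hy n))).2
  have h3 := (abs_le.1 (happ (p n) _ hw)).2
  have h4 := hg n
  have h5 := (abs_le.1 ((r n).le_opNorm (y n - w))).1
  have h6 : ‖r n‖ * ‖y n - w‖ ≤ ‖r n‖ := mul_le_of_le_one_right (norm_nonneg _) hnear.le
  have h7 : ‖r n‖ ≤ 1 := (hlt n).le.trans (by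
    rw [div_le_one (by positivity)]; linarith [n.cast_nonneg (α := ℝ)])
  rw [hfx n] at hfw
  rw [map_sub] at h5
  nlinarith [hadd n, hrpos n, mul_lt_mul_of_pos_left hnear (hrpos n)]

theorem finiteDimensional_annihilatorInDual {Y : Type*} [NormedAddCommGroup Y]
    [NormedSpace ℝ Y] {Z : Submodule ℝ Y} (hcodim : FiniteDimensional ℝ (Y ⧸ Z)) :
    FiniteDimensional ℝ (annihilatorInDual Z) := by
  let A : annihilatorInDual Z →ₗ[ℝ] Module.Dual ℝ (Y ⧸ Z) :=
    { toFun := fun f => Z.liftQ (f : StrongDual ℝ Y).toLinearMap fun z hz => f.2 z hz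
      map_add' := fun f g => by ext; rfl
      map_smul' := fun c f => by ext; rfl }
  refine FiniteDimensional.of_injective A fun f g hfg => ?_
  ext x
  exact LinearMap.congr_fun hfg (Z.mkQ x)

/-! ### Simple functions and averaging in `L¹` -/

/-- A finite measure on a separable metric space whose nonzero values are bounded below is
concentrated on a finite set. -/
theorem exists_finset_measure_compl_eq_zero {S : Type*} [MetricSpace S]
    [SecondCountableTopology S] [MeasurableSpace S] [BorelSpace S] (ν : Measure S)
    [IsFiniteMeasure ν] {δ : ENNReal} (hδ : δ ≠ 0)
    (h : ∀ B, MeasurableSet B → ν B ≠ 0 → δ ≤ ν B) : ∃ T : Finset S, ν (T : Set S)ᶜ = 0 := by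
  -- Only finitely many atoms have mass at least `δ`. Any other point has a neighbourhood of mass
  -- below `δ`, hence null, and second countability makes the complement of the atoms null.
  have hfin : {x : S | δ ≤ ν {x}}.Finite :=
    Measure.finite_const_le_meas_of_disjoint_iUnion ν (pos_iff_ne_zero.2 hδ)
      (fun x => measurableSet_singleton x)
      (fun x y hxy => Set.disjoint_singleton.2 hxy) (measure_ne_top _ _)
  refine ⟨hfin.toFinset, measure_null_of_locally_null _ fun x hx => ?_⟩
  have hx' : ν {x} < δ := by simpa using hx
  obtain ⟨U, hxU, hUo, hU⟩ := Set.exists_isOpen_lt_of_lt {x} δ hx'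
  refine ⟨U, mem_nhdsWithin_of_mem_nhds (hUo.mem_nhds (hxU rfl)), ?_⟩
  by_contra hne
  exact (h U hUo.measurableSet hne).not_gt hU

/-- Cutting `f` along `A` and its complement gives `p` and `r` with disjoint supports, so `p + r`
and `p - r` both have norm `‖p‖ + ‖r‖`. -/
theorem HasIsolatedSummands.le_lintegral {Ω : Type*} [MeasurableSpace Ω] {μ : Measure Ω}
    {f : Lp ℝ 1 μ} (hf : HasIsolatedSummands f) :
    ∃ δ > 0, ∀ A, MeasurableSet A → ∫⁻ ω in A, ‖f ω‖ₑ ∂μ ≠ 0 →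
      ENNReal.ofReal δ ≤ ∫⁻ ω in A, ‖f ω‖ₑ ∂μ := by
  obtain ⟨δ, hδ, h⟩ := hf
  refine ⟨δ, hδ, fun A hA hne => ?_⟩
  have hm := Lp.memLp f
  have hint : Integrable f μ := L1.integrable_coeFn f
  let r : Lp ℝ 1 μ := (hm.indicator hA).toLp _
  let p : Lp ℝ 1 μ := (hm.indicator hA.compl).toLp _
  have hr : r =ᵐ[μ] A.indicator f := MemLp.coeFn_toLp _
  have hp : p =ᵐ[μ] Aᶜ.indicator f := MemLp.coeFn_toLp _
  have hrn : ‖r‖ = ∫ ω in A, ‖f ω‖ ∂μ := by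
    rw [L1.norm_eq_integral_norm, ← integral_indicator hA]
    refine integral_congr_ae ?_
    filter_upwards [hr] with ω hω
    rw [hω, norm_indicator_eq_indicator_norm]
  have hpn : ‖p‖ = ∫ ω in Aᶜ, ‖f ω‖ ∂μ := by
    rw [L1.norm_eq_integral_norm, ← integral_indicator hA.compl]
    refine integral_congr_ae ?_
    filter_upwards [hp] with ω hω
    rw [hω, norm_indicator_eq_indicator_norm]
  have hfr : ENNReal.ofReal ‖r‖ = ∫⁻ ω in A, ‖f ω‖ₑ ∂μ := by
    rw [hrn, ofReal_integral_norm_eq_lintegral_enorm hint.integrableOn]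
  rw [← hfr]
  refine ENNReal.ofReal_le_ofReal (h p r ?_ ?_ ?_ ?_)
  · refine Lp.ext ?_
    filter_upwards [hr, hp, Lp.coeFn_add p r] with ω h1 h2 h3
    rw [h3, Pi.add_apply, h1, h2]
    by_cases hω : ω ∈ A <;> simp [hω]
  · rw [hrn, hpn, L1.norm_eq_integral_norm, add_comm, integral_add_compl hA hint.norm]
  · rw [L1.norm_eq_integral_norm, L1.norm_eq_integral_norm]
    refine integral_congr_ae ?_
    filter_upwards [hr, hp, Lp.coeFn_sub p r] with ω h1 h2 h3
    rw [h3, Pi.sub_apply, h1, h2]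
    by_cases hω : ω ∈ A <;> simp [hω]
  · intro h0
    rw [h0, norm_zero, ENNReal.ofReal_zero] at hfr
    exact hne hfr.symm

/-- Averaging over finitely many disjoint sets of finite measure is a contraction of `L¹`. -/
theorem exists_averaging_operator {Ω ι : Type*} [MeasurableSpace Ω] (μ : Measure Ω)
    (T : Finset ι) (A : ι → Set Ω) (hA : ∀ v, MeasurableSet (A v))
    (hdisj : Pairwise (Function.onFun Disjoint A)) (hμ : ∀ v ∈ T, μ (A v) ≠ ⊤) :
    ∃ Q : Lp ℝ 1 μ →L[ℝ] Lp ℝ 1 μ, ‖Q‖ ≤ 1 ∧ FiniteDimensional ℝ Q.range ∧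
      ∀ (g : Lp ℝ 1 μ) (c : ι → ℝ), (∀ v ∈ T, ∀ᵐ ω ∂μ, ω ∈ A v → g ω = c v) →
        (∀ᵐ ω ∂μ, (∀ v ∈ T, ω ∉ A v) → g ω = 0) → Q g = g := by
  classical
  -- The value `0` is only a default: for `v ∈ T` the measure is finite.
  let e : ι → Lp ℝ 1 μ := fun v =>
    if h : μ (A v) ≠ ⊤ then indicatorConstLp 1 (hA v) h (1 : ℝ) else 0
  have he : ∀ v (hv : v ∈ T), e v = indicatorConstLp 1 (hA v) (hμ v hv) (1 : ℝ) := fun v hv =>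
    dif_pos (hμ v hv)
  let I : ι → Lp ℝ 1 μ →ₗ[ℝ] ℝ := fun v =>
    { toFun := fun g => ∫ ω in A v, g ω ∂μ
      map_add' := fun g h => by
        rw [← integral_add (L1.integrable_coeFn g).integrableOn
          (L1.integrable_coeFn h).integrableOn]
        exact integral_congr_ae (ae_restrict_of_ae (Lp.coeFn_add g h))
      map_smul' := fun c g => by
        rw [RingHom.id_apply, smul_eq_mul, ← integral_const_mul]
        exact integral_congr_ae (ae_restrict_of_ae (Lp.coeFn_smul c g)) }
  let Q₀ : Lp ℝ 1 μ →ₗ[ℝ] Lp ℝ 1 μ :=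
    ∑ v ∈ T, (μ.real (A v))⁻¹ • (I v).smulRight (e v)
  have hQ₀ : ∀ g, Q₀ g = ∑ v ∈ T, ((μ.real (A v))⁻¹ * ∫ ω in A v, g ω ∂μ) • e v := fun g => by
    simp only [Q₀, LinearMap.sum_apply, LinearMap.smul_apply, LinearMap.smulRight_apply, smul_smul]
    rfl
  have hbound : ∀ g, ‖Q₀ g‖ ≤ 1 * ‖g‖ := fun g => by
    have hint := L1.integrable_coeFn g
    calc ‖Q₀ g‖ ≤ ∑ v ∈ T, ∫ ω in A v, ‖g ω‖ ∂μ := by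
          rw [hQ₀]
          refine norm_sum_le_of_le T fun v hv => ?_
          rw [norm_smul, norm_mul, he v hv, norm_indicatorConstLp one_ne_zero ENNReal.one_ne_top,
            norm_one, norm_inv, Real.norm_of_nonneg measureReal_nonneg]
          simp only [ENNReal.toReal_one, div_one, Real.rpow_one, one_mul]
          have h1 := norm_integral_le_integral_norm (μ := μ.restrict (A v)) g
          rcases eq_or_ne (μ.real (A v)) 0 with h0 | h0
          · rw [h0]
            simpa using (norm_nonneg _).trans h1
          · rw [mul_comm, mul_inv_cancel_left₀ h0]
            exact h1
      _ = ∫ ω in ⋃ v ∈ T, A v, ‖g ω‖ ∂μ :=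
          (integral_biUnion_finset T (fun v _ => hA v) (hdisj.set_pairwise _)
            fun v _ => hint.norm.integrableOn).symm
      _ ≤ ∫ ω, ‖g ω‖ ∂μ :=
          setIntegral_le_integral hint.norm (Eventually.of_forall fun _ => norm_nonneg _)
      _ = 1 * ‖g‖ := by rw [one_mul, L1.norm_eq_integral_norm]
  refine ⟨Q₀.mkContinuous 1 hbound, LinearMap.mkContinuous_norm_le _ zero_le_one _, ?_, ?_⟩
  · have : FiniteDimensional ℝ (Submodule.span ℝ (e '' T)) :=
      FiniteDimensional.span_of_finite ℝ (T.finite_toSet.image e)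
    refine Submodule.finiteDimensional_of_le (S₂ := Submodule.span ℝ (e '' T)) ?_
    rintro _ ⟨g, rfl⟩
    change Q₀ g ∈ _
    rw [hQ₀]
    exact Submodule.sum_mem _ fun v hv =>
      Submodule.smul_mem _ _ (Submodule.subset_span ⟨v, hv, rfl⟩)
  · intro g c hc h0
    change Q₀ g = g
    have hterm : ∀ v ∈ T, ((μ.real (A v))⁻¹ * ∫ ω in A v, g ω ∂μ) • e v = c v • e v := by
      intro v hv
      rw [setIntegral_congr_ae (hA v) (hc v hv), setIntegral_const, smul_eq_mul]
      rcases eq_or_ne (μ.real (A v)) 0 with hz | hz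
      -- On a null set the average is meaningless, but `e v` vanishes in `L¹`.
      · have : e v = 0 := by
          rw [← norm_eq_zero, he v hv,
            norm_indicatorConstLp one_ne_zero ENNReal.one_ne_top, hz]
          simp
        simp [this]
      · rw [inv_mul_cancel_left₀ hz]
    rw [hQ₀, Finset.sum_congr rfl hterm]
    have hsum : (∑ v ∈ T, c v • e v : Lp ℝ 1 μ) =ᵐ[μ]
        fun ω => ∑ v ∈ T, c v * (A v).indicator (fun _ => (1 : ℝ)) ω := by
      have h1 := Lp.coeFn_finsetSum (μ := μ) (p := 1) T fun v => c v • e v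
      have h2 : ∀ᵐ ω ∂μ, ∀ v ∈ T, (c v • e v) ω = c v * (A v).indicator (fun _ => (1 : ℝ)) ω := by
        refine (Finset.eventually_all T).2 fun v hv => ?_
        have h3 : e v =ᵐ[μ] (A v).indicator fun _ => (1 : ℝ) := by
          rw [he v hv]; exact indicatorConstLp_coeFn
        filter_upwards [Lp.coeFn_smul (c v) (e v), h3] with ω h4 h5
        rw [h4, Pi.smul_apply, h5, smul_eq_mul]
      filter_upwards [h1, h2] with ω h3 h4
      rw [h3, Finset.sum_apply]
      exact Finset.sum_congr rfl h4
    refine Lp.ext ?_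
    filter_upwards [hsum, h0, (Finset.eventually_all T).2 hc] with ω h1 h2 h3
    rw [h1]
    by_cases hω : ∃ v ∈ T, ω ∈ A v
    · obtain ⟨v, hv, hωv⟩ := hω
      rw [Finset.sum_eq_single_of_mem v hv, h3 v hv hωv, Set.indicator_of_mem hωv, mul_one]
      intro u _ huv
      rw [Set.indicator_of_notMem (Set.disjoint_right.1 (hdisj huv) hωv), mul_zero]
    · push Not at hω
      rw [h2 hω]
      exact Finset.sum_eq_zero fun v hv => by rw [Set.indicator_of_notMem (hω v hv), mul_zero]

/-- A finite dimensional subspace of `L¹` whose elements have isolated summands is contained in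
the range of a contractive finite rank projection. -/
theorem exists_contraction_fixing {Ω : Type*} [MeasurableSpace Ω] {μ : Measure Ω}
    (V : Submodule ℝ (Lp ℝ 1 μ)) [FiniteDimensional ℝ V]
    (hV : ∀ f ∈ V, HasIsolatedSummands f) :
    ∃ Q : Lp ℝ 1 μ →L[ℝ] Lp ℝ 1 μ, ‖Q‖ ≤ 1 ∧ FiniteDimensional ℝ Q.range ∧ ∀ f ∈ V, Q f = f := by
  let b := Module.finBasis ℝ V
  let f : Fin (Module.finrank ℝ V) → Lp ℝ 1 μ := fun i => b i
  have hfm : ∀ i, Measurable (f i) := fun i => (Lp.stronglyMeasurable (f i)).measurable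
  have hfint : ∀ i, Integrable (f i) μ := fun i => L1.integrable_coeFn _
  let F : Ω → Fin (Module.finrank ℝ V) → ℝ := fun ω i => f i ω
  have hF : Measurable F := measurable_pi_lambda _ hfm
  choose δ hδ hδle using fun i => (hV (f i) (b i).2).le_lintegral
  obtain ⟨c, hcδ, hc⟩ : ∃ c : ℝ, (∀ i, c ≤ δ i) ∧ 0 < c := by
    have h1 : ∀ᶠ c in 𝓝[>] (0 : ℝ), ∀ i, c ≤ δ i :=
      eventually_all.2 fun i => mem_nhdsWithin_of_mem_nhds (Iic_mem_nhds (hδ i))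
    exact (h1.and self_mem_nhdsWithin).exists
  let h : Ω → ENNReal := fun ω => ∑ i, ‖f i ω‖ₑ
  have hh : Measurable h := Finset.measurable_sum _ fun i _ => (hfm i).enorm
  -- The joint distribution of the basis functions, weighted by the sum of their absolute values. A
  -- finite support for `ν` means that `F` takes finitely many values wherever it is nonzero, up to
  -- a null set.
  let ν : Measure (Fin (Module.finrank ℝ V) → ℝ) := (μ.withDensity h).map F
  have hν : ∀ B, MeasurableSet B → ν B = ∑ i, ∫⁻ ω in F ⁻¹' B, ‖f i ω‖ₑ ∂μ := fun B hB => by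
    rw [Measure.map_apply hF hB, withDensity_apply _ (hF hB),
      lintegral_finsetSum _ fun i _ => (hfm i).enorm]
  have hfin : IsFiniteMeasure ν := ⟨by
    rw [hν _ MeasurableSet.univ]
    exact ENNReal.sum_lt_top.2 fun i _ =>
      (setLIntegral_le_lintegral _ _).trans_lt (hfint i).hasFiniteIntegral⟩
  obtain ⟨T, hT⟩ := exists_finset_measure_compl_eq_zero ν (δ := ENNReal.ofReal c)
    (by simpa using hc) fun B hB hne => by
      rw [hν B hB] at hne ⊢
      obtain ⟨i, -, hi⟩ := Finset.exists_ne_zero_of_sum_ne_zero hne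
      exact ((ENNReal.ofReal_le_ofReal (hcδ i)).trans (hδle i _ (hF hB) hi)).trans
        (Finset.single_le_sum (f := fun i => ∫⁻ ω in F ⁻¹' B, ‖f i ω‖ₑ ∂μ)
          (fun _ _ => zero_le) (Finset.mem_univ i))
  have hae : ∀ᵐ ω ∂μ, F ω ∉ T → ∀ i, f i ω = 0 := by
    have hTm : MeasurableSet (T : Set (Fin (Module.finrank ℝ V) → ℝ))ᶜ := T.measurableSet.compl
    rw [hν _ hTm, Finset.sum_eq_zero_iff] at hT
    have h1 : ∀ᵐ ω ∂μ, ∀ i, F ω ∈ (T : Set (Fin (Module.finrank ℝ V) → ℝ))ᶜ → f i ω = 0 := by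
      refine eventually_all.2 fun i => ?_
      have h2 := (lintegral_eq_zero_iff (hfm i).enorm).1 (hT i (Finset.mem_univ i))
      filter_upwards [(ae_restrict_iff' (hF hTm)).1 h2] with ω h3 h4
      simpa using h3 h4
    filter_upwards [h1] with ω h2 h3 i using h2 i (by simpa using h3)
  classical
  -- The value `0` is removed because `F = 0` may have infinite measure. For `v` with `v i ≠ 0`, the
  -- set `F = v` lies in `|f i| ≥ |v i|`, of finite measure by integrability.
  obtain ⟨Q, hQ, hfr, hfix⟩ := exists_averaging_operator μ (T.erase 0) (fun v => F ⁻¹' {v})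
    (fun v => hF (measurableSet_singleton v))
    (fun u v huv => (Set.disjoint_singleton.2 huv).preimage F) (fun v hv => by
      obtain ⟨i, hi⟩ := Function.ne_iff.1 (Finset.ne_of_mem_erase hv)
      refine ((measure_mono ?_).trans_lt
        ((hfint i).measure_norm_ge_lt_top (norm_pos_iff.2 hi))).ne
      rintro ω rfl
      exact le_refl ‖f i ω‖)
  have hQb : ∀ i, Q (f i) = f i := fun i => by
    refine hfix (f i) (fun v => v i) (fun v _ => Eventually.of_forall ?_) ?_
    · rintro ω rfl
      rfl
    · filter_upwards [hae] with ω h1 h2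
      by_cases hω : F ω ∈ T
      · by_contra hne
        refine h2 (F ω) (Finset.mem_erase.2 ⟨fun h0 => hne (congrFun h0 i), hω⟩) rfl
      · exact h1 hω i
  refine ⟨Q, hQ, hfr, fun g hg => ?_⟩
  have h1 : Q.toLinearMap ∘ₗ V.subtype = V.subtype := b.ext hQb
  exact LinearMap.congr_fun h1 ⟨g, hg⟩

theorem HasIsolatedSummands.map {E F : Type*} [NormedAddCommGroup E] [NormedSpace ℝ E]
    [NormedAddCommGroup F] [NormedSpace ℝ F] {f : E} (hf : HasIsolatedSummands f)
    (U : E ≃ₗᵢ[ℝ] F) : HasIsolatedSummands (U f) := by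
  obtain ⟨δ, hδ, h⟩ := hf
  refine ⟨δ, hδ, fun p r hpr hadd hsub hr => ?_⟩
  rw [← U.symm.norm_map r]
  refine h (U.symm p) (U.symm r) ?_ ?_ ?_ ?_
  · rw [← map_add, ← hpr, U.symm_apply_apply]
  · rwa [U.symm.norm_map, U.symm.norm_map, ← U.norm_map f]
  · rwa [← map_sub, U.symm.norm_map, ← U.norm_map f]
  · simpa using hr

/-! ### The reduction for `Z^{⊥⊥}` and the main theorem -/

/-- The averaging operator is transported from `L¹(μ)` to `Y*`. It need not be an adjoint of an
operator on `Y`, so the reduction appears only in the bidual. -/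
theorem hasContractiveReduction_biannihilator {Y : Type v} [NormedAddCommGroup Y]
    [NormedSpace ℝ Y] (hY : IsL1Predual.{v, w} Y) {Z : Submodule ℝ Y}
    (hcodim : FiniteDimensional ℝ (Y ⧸ Z)) (hZ : IsStronglyProximinal Z) :
    HasContractiveReduction (annihilatorInDual (annihilatorInDual Z)) := by
  obtain ⟨Ω, _, μ, ⟨U⟩⟩ := hY
  have := finiteDimensional_annihilatorInDual hcodim
  obtain ⟨Q, hQ, hfin, hfix⟩ := exists_contraction_fixing
    ((annihilatorInDual Z).map (U.toLinearEquiv : StrongDual ℝ Y →ₗ[ℝ] Lp ℝ 1 μ)) (by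
      rintro _ ⟨f, hf, rfl⟩
      exact (hZ.hasIsolatedSummands hcodim hf).map U)
  let UL : StrongDual ℝ Y →L[ℝ] Lp ℝ 1 μ := U.toContinuousLinearEquiv
  let US : Lp ℝ 1 μ →L[ℝ] StrongDual ℝ Y := U.symm.toContinuousLinearEquiv
  refine .of_fixing _ (US.comp (Q.comp UL)) ?_ ?_ fun f hf => ?_
  · refine ContinuousLinearMap.opNorm_le_bound _ zero_le_one fun f => ?_
    change ‖U.symm (Q (U f))‖ ≤ _
    rw [U.symm.norm_map, ← U.norm_map f]
    exact Q.le_of_opNorm_le hQ _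
  · refine Submodule.finiteDimensional_of_le
      (S₂ := Q.range.map (U.symm.toLinearEquiv : Lp ℝ 1 μ →ₗ[ℝ] StrongDual ℝ Y)) ?_
    rintro _ ⟨f, rfl⟩
    exact ⟨Q (U f), ⟨_, rfl⟩, rfl⟩
  · change U.symm (Q (U f)) = f
    rw [hfix (U f) ⟨f, hf, rfl⟩, U.symm_apply_apply]

/-! Reflexivity of `X` and `hpos` are not used below: `hpos` holds automatically, because
`K(X, Y) / K(X, Z)` is `L(X, Y ⧸ Z)`, and the minimisers are pointwise limits of operators into a
finite dimensional space, which exist for every `X`. -/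

theorem theorem7 {X : Type u} [NormedAddCommGroup X] [NormedSpace ℝ X] [CompleteSpace X]
    (hX : IsReflexiveSpace X)
    {Y : Type v} [NormedAddCommGroup Y] [NormedSpace ℝ Y] [CompleteSpace Y]
    (hY : IsL1Predual.{v, w} Y)
    (Z : Submodule ℝ Y) (hcodim : FiniteDimensional ℝ (Y ⧸ Z)) (hZ : IsStronglyProximinal Z)
    (hpos : ∀ (k : ℕ) (f : Fin k → StrongDual ℝ Y), IsMinimalExtremeFrame Z k f →
      annihilatorInDual (compactOpsInto X Z) ≤
        tensorSubspace X (Submodule.span ℝ (Set.range f))) :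
    -- every compact operator into the bidual has a best approximation
    (∀ T : CompactOps X (StrongDual ℝ (StrongDual ℝ Y)),
      ∃ S ∈ compactOpsInto X (annihilatorInDual (annihilatorInDual Z)),
        Metric.infDist T (compactOpsInto X (annihilatorInDual (annihilatorInDual Z)) :
          Set (CompactOps X (StrongDual ℝ (StrongDual ℝ Y)))) = ‖T - S‖) ∧
    -- proximinality for the duals of order 2, 4, 6, ..., also after any identification with C(K)
    (∀ n : ℕ, 1 ≤ n →
      CompactOpsProximinal X (evenDual Y Z n).sub ∧
      ∀ (K : Type t) [TopologicalSpace K] [CompactSpace K] [T2Space K]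
        (J : (evenDual Y Z n).carrier ≃ₗᵢ[ℝ] C(K, ℝ)),
        CompactOpsProximinal X
          ((evenDual Y Z n).sub.map (J.toLinearEquiv : (evenDual Y Z n).carrier →ₗ[ℝ] C(K, ℝ)))) := by
  have hred := hasContractiveReduction_biannihilator hY hcodim hZ
  refine ⟨fun T => ?_, fun n hn => ?_⟩
  · obtain ⟨S, hS, h⟩ :=
      (CompactOpsProximinal.of_reduction X (isClosed_annihilatorInDual _) hred).2 T
    exact ⟨S, hS, h.symm⟩
  · obtain ⟨m, rfl⟩ := Nat.exists_eq_add_of_le' hn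
    obtain ⟨hcl, hr⟩ := evenDual_reduction hred m
    exact ⟨.of_reduction X hcl hr, fun K _ _ _ J =>
      .of_reduction X (isClosed_map_linearIsometryEquiv hcl J) (hr.map J)⟩
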